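/- For $n\ge 0$ let $\mathrm{Av}_n(123)$ be the set of permutations $p=p_1p_2\cdots p_n$ of $\{1,\dots,n\}$ containing no occurrence of the pattern $123$, where an occurrence of a pattern $q\in S_k$ in $p$ is a choice of positions $i_1<\cdots<i_k$ such that $p_{i_1}\cdots p_{i_k}$ is in the same relative order as $q$. Let $C(x)=\sum_{n\ge0}\frac{1}{n+1}\binom{2n}{n}x^n$ be the generating function of the Catalan numbers. Let $b_n$ be the total number of occurrences of $231$ in all permutations in $\mathrm{Av}_n(123)$. Then $b_n$ is also the total number of occurrences of $312$ in all permutations in $\mathrm{Av}_n(123)$, and, as formal power series, $$\sum_{n\ge0} b_nx^n=\frac{x^3C(x)^3}{(1-2xC(x))(1-4x)^{3/2}}=\frac12\left(\frac{1-3x}{(1-4x)^{2}}-\frac{4x^2-5x+1}{(1-4x)^{5/2}}\right).$$ -/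

import Mathlib

namespace PermPattern

/-- The position map `f` picks out an occurrence of the pattern `q ∈ S_k` in `p ∈ S_n`: the positions
`f 0 < f 1 < ⋯` increase, and the entries of `p` there are in the same relative order as those
of `q`. Permutations are in one-line notation (`p i` is the entry at position `i`), with positions
and entries counted from `0`. -/
abbrev IsOccurrence {n k : ℕ} (q : Equiv.Perm (Fin k)) (p : Equiv.Perm (Fin n))
    (f : Fin k → Fin n) : Prop :=
  (∀ i j, i < j → f i < f j) ∧ ∀ i j, q i < q j ↔ p (f i) < p (f j)

/-- `p` contains `q` as a pattern. -/
abbrev Contains {n k : ℕ} (q : Equiv.Perm (Fin k)) (p : Equiv.Perm (Fin n)) : Prop :=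
  ∃ f : Fin k → Fin n, IsOccurrence q p f

/-- The number of occurrences of `q` in `p`. -/
def num {n k : ℕ} (q : Equiv.Perm (Fin k)) (p : Equiv.Perm (Fin n)) : ℕ :=
  (Finset.univ.filter fun f : Fin k → Fin n => IsOccurrence q p f).card

/-- The set of permutations of length `n` that avoid `r`. -/
def Av (n : ℕ) {m : ℕ} (r : Equiv.Perm (Fin m)) : Finset (Equiv.Perm (Fin n)) :=
  Finset.univ.filter fun p => ¬ Contains r p

/-- The total number of occurrences of `q` in a finite set `S` of permutations of length `n`. -/
def total {n k : ℕ} (q : Equiv.Perm (Fin k)) (S : Finset (Equiv.Perm (Fin n))) : ℕ :=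
  ∑ p ∈ S, num q p

/-- The permutation 123. -/
def pat123 : Equiv.Perm (Fin 3) := 1

/-- The permutation 231. -/
def pat231 : Equiv.Perm (Fin 3) where
  toFun := ![1, 2, 0]
  invFun := ![2, 0, 1]
  left_inv := by decide
  right_inv := by decide

/-- The permutation 312. -/
def pat312 : Equiv.Perm (Fin 3) where
  toFun := ![2, 0, 1]
  invFun := ![1, 2, 0]
  left_inv := by decide
  right_inv := by decide

/-- The Catalan generating function `C(x)`, over the rationals. -/
noncomputable def catalanGF : PowerSeries ℚ :=
  PowerSeries.map (Nat.castRingHom ℚ) PowerSeries.catalanSeries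

/-- The formal power series `(1 - 4x)^r` for rational `r`: the binomial series `(1 + y)^r`
at `y = -4x`. -/
noncomputable def oneSubFourXPow (r : ℚ) : PowerSeries ℚ :=
  PowerSeries.rescale (-4 : ℚ) (PowerSeries.binomialSeries ℚ r)

end PermPattern

/-!
A `123`-avoiding permutation grows by appending a last entry `v`, which is allowed exactly when the
entries less than `v` are decreasing. An occurrence of the pattern `k ⋯ 1 (k + 1)` that uses the new
entry is then a choice of `k` of these `v` entries, so the total number of occurrences satisfies a
linear recurrence in which the number of decreasing small entries is tracked as well. Write
`r = x C(x)` and `s = 1 - 2r = √(1 - 4x)`. The kernel of the recurrence factors as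
`z² - z + x = (z - r) (z - (1 - r))`, and its solution is `(r / s) ^ (k + 1)`: this is `(r / s)²`
for the pattern `12` and `(r / s)³` for `213`.

The pattern `231` is reached by averaging. Each occurrence of `12` lies in `n - 2` sets of three
positions, and the totals of `132` and `213` agree, as do those of `231` and `312`; hence
`n - 2` times the total of `12` is four times the total of `213` plus twice that of `231`.
-/

namespace PermPattern

open Finset Equiv PowerSeries

section Occurrences

variable {n k m : ℕ} {q : Perm (Fin k)} {p : Perm (Fin n)} {τ : Perm (Fin m)}

theorem IsOccurrence.strictMono {f : Fin k → Fin n} (hf : IsOccurrence q p f) : StrictMono f :=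
  fun _ _ => hf.1 _ _

theorem IsOccurrence.comp_iff {g : Fin m → Fin n} (hg : IsOccurrence τ p g) {f : Fin k → Fin m} :
    IsOccurrence q p (g ∘ f) ↔ IsOccurrence q τ f := by
  simp only [IsOccurrence, Function.comp_apply, hg.strictMono.lt_iff_lt, hg.2]

theorem IsOccurrence.inv {f : Fin k → Fin n} (hf : IsOccurrence q p f) :
    IsOccurrence q⁻¹ p⁻¹ (p ∘ f ∘ q.symm) :=
  ⟨fun i j hij => (hf.2 _ _).1 (by simpa using hij), fun i j => by
    simp [hf.strictMono.lt_iff_lt]⟩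

/-- The reverse-complement of a permutation: its one-line notation read backwards, with the order
of the entries reversed. -/
def revComp (p : Perm (Fin n)) : Perm (Fin n) :=
  Fin.revPerm * p * Fin.revPerm

theorem revComp_involutive : Function.Involutive (revComp (n := n)) :=
  fun p => by ext; simp [revComp]

theorem IsOccurrence.revComp {f : Fin k → Fin n} (hf : IsOccurrence q p f) :
    IsOccurrence (revComp q) (revComp p) (Fin.rev ∘ f ∘ Fin.rev) :=
  ⟨fun i j hij => by simpa [hf.strictMono.lt_iff_lt] using hij, fun i j => by
    simpa [PermPattern.revComp] using hf.2 j.rev i.rev⟩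

theorem num_le_num {q' : Perm (Fin k)} {p' : Perm (Fin n)} (e : (Fin k → Fin n) → Fin k → Fin n)
    (he : Function.Injective e) (h : ∀ f, IsOccurrence q p f → IsOccurrence q' p' (e f)) :
    num q p ≤ num q' p' :=
  card_le_card_of_injOn e (fun f hf => by simpa using h f (by simpa using hf)) he.injOn

theorem num_inv (q : Perm (Fin k)) (p : Perm (Fin n)) : num q⁻¹ p⁻¹ = num q p := by
  have le (q : Perm (Fin k)) (p : Perm (Fin n)) : num q p ≤ num q⁻¹ p⁻¹ :=
    num_le_num (fun f => p ∘ f ∘ q.symm)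
      (p.injective.comp_left.comp q.symm.surjective.injective_comp_right) fun _ => IsOccurrence.inv
  exact (by simpa only [inv_inv] using le q⁻¹ p⁻¹ : num q⁻¹ p⁻¹ ≤ num q p).antisymm (le q p)

theorem num_revComp (q : Perm (Fin k)) (p : Perm (Fin n)) :
    num (revComp q) (revComp p) = num q p := by
  have le (q : Perm (Fin k)) (p : Perm (Fin n)) : num q p ≤ num (revComp q) (revComp p) :=
    num_le_num (fun f => Fin.rev ∘ f ∘ Fin.rev)
      (Fin.rev_injective.comp_left.comp Fin.rev_surjective.injective_comp_right)
      fun _ => IsOccurrence.revComp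
  exact (by simpa only [revComp_involutive _] using le (revComp q) (revComp p) :
    num (revComp q) (revComp p) ≤ num q p).antisymm (le q p)

theorem mem_Av_iff_num_eq_zero : p ∈ Av n q ↔ num q p = 0 := by
  simp [Av, num, Contains, filter_eq_empty_iff]

theorem total_eq_of_num_eq {r r' : Perm (Fin m)} {q q' : Perm (Fin k)}
    {e : Perm (Fin n) → Perm (Fin n)}
    (he : Function.Involutive e) (hq : ∀ p, num q' (e p) = num q p)
    (hr : ∀ p, num r' (e p) = num r p) : total q' (Av n r') = total q (Av n r) :=
  sum_equiv he.toPerm (fun p => by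
    simp [mem_Av_iff_num_eq_zero, ← hr (e p), he p]) fun p _ => by
    simp [← hq (e p), he p]

theorem total_inv (q : Perm (Fin k)) (r : Perm (Fin m)) :
    total q⁻¹ (Av n r⁻¹) = total q (Av n r) :=
  total_eq_of_num_eq inv_involutive (num_inv q) (num_inv r)

theorem total_revComp (q : Perm (Fin k)) (r : Perm (Fin m)) :
    total (revComp q) (Av n (revComp r)) = total q (Av n r) :=
  total_eq_of_num_eq revComp_involutive (num_revComp q) (num_revComp r)

end Occurrences

section DoubleCounting

variable {n k m : ℕ}

theorem existsUnique_isOccurrence (p : Perm (Fin n)) {g : Fin m → Fin n} (hg : StrictMono g) :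
    ∃! τ : Perm (Fin m), IsOccurrence τ p g := by
  have hsort : StrictMono ((p ∘ g) ∘ Tuple.sort (p ∘ g)) :=
    (Tuple.monotone_sort _).strictMono_of_injective
      ((p.injective.comp hg.injective).comp (Tuple.sort _).injective)
  refine ⟨(Tuple.sort (p ∘ g))⁻¹, ⟨fun _ _ h => hg h, fun i j => ?_⟩, fun τ hτ => ?_⟩
  · simpa using (hsort.lt_iff_lt (a := (Tuple.sort (p ∘ g))⁻¹ i)
      (b := (Tuple.sort (p ∘ g))⁻¹ j)).symm
  · have hτ' : StrictMono ((p ∘ g) ∘ (τ⁻¹ : Perm (Fin m))) :=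
      fun i j hij => (hτ.2 _ _).1 (by simpa using hij)
    rw [← inv_inj, inv_inv, Tuple.eq_sort_iff]
    exact ⟨hτ'.monotone, fun i j hij h => absurd h (hτ' hij).ne⟩

theorem card_strictMono_filter_image {α : Type*} [Fintype α] [LinearOrder α]
    (P : Finset α → Prop) [DecidablePred P] :
    #{g : Fin m → α | StrictMono g ∧ P (univ.image g)} =
      #{S ∈ powersetCard m (univ : Finset α) | P S} := by
  refine card_bij (fun g _ => univ.image g) (fun g hg => ?_) (fun g hg g' hg' h => ?_)
    fun S hS => ?_
  · simp only [mem_filter, mem_univ, true_and] at hg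
    simpa [hg.2] using card_image_of_injective univ hg.1.injective
  · simp only [mem_filter, mem_univ, true_and] at hg hg'
    exact (hg.1.range_inj hg'.1).1 (by simpa using congrArg ((↑) : Finset α → Set α) h)
  · simp only [mem_filter, mem_powersetCard, subset_univ, true_and] at hS
    exact ⟨S.orderEmbOfFin hS.1, by simpa using ⟨(S.orderEmbOfFin hS.1).strictMono, hS.2⟩, by simp⟩

theorem card_powersetCard_filter_superset {α : Type*} [Fintype α] [DecidableEq α] {T : Finset α}
    (hT : #T ≤ m) :
    #{S ∈ powersetCard m univ | T ⊆ S} = (Fintype.card α - #T).choose (m - #T) := by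
  rw [← card_compl, ← card_powersetCard]
  refine card_nbij' (· \ T) (· ∪ T) (fun S hS => ?_) (fun U hU => ?_) (fun S hS => ?_)
    fun U hU => ?_
  · obtain ⟨hS, hTS⟩ : #S = m ∧ T ⊆ S := by simpa using hS
    simp [subset_compl_iff_disjoint_right, sdiff_disjoint, card_sdiff_of_subset hTS, hS]
  · obtain ⟨hUT, hU⟩ : Disjoint U T ∧ #U = m - #T := by
      simpa [subset_compl_iff_disjoint_right] using hU
    simp [card_union_of_disjoint hUT, hU, hT]
  · exact sdiff_union_of_subset (by simp_all)
  · exact union_sdiff_cancel_right (by simp_all [subset_compl_iff_disjoint_right])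

theorem card_isOccurrence_comp (q : Perm (Fin k)) (p : Perm (Fin n)) {g : Fin m → Fin n}
    (hg : StrictMono g) :
    #{f : Fin k → Fin m | IsOccurrence q p (g ∘ f)} =
      #{h : Fin k → Fin n | IsOccurrence q p h ∧ univ.image h ⊆ univ.image g} := by
  refine card_bij (fun f _ => g ∘ f) (fun f hf => ?_) (fun f _ f' _ => ?_) fun h hh => ?_
  · simpa [image_subset_iff] using hf
  · exact fun e => hg.injective.comp_left e
  · obtain ⟨hocc, hsub⟩ : IsOccurrence q p h ∧ ∀ i, ∃ j, g j = h i := by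
      simpa [image_subset_iff] using hh
    choose f hf using hsub
    obtain rfl : g ∘ f = h := funext hf
    exact ⟨f, by simpa using hocc, rfl⟩

theorem sum_num_mul_num_eq_sum_strictMono (q : Perm (Fin k)) (p : Perm (Fin n)) :
    ∑ τ : Perm (Fin m), num q τ * num τ p =
      ∑ g : Fin m → Fin n with StrictMono g,
        #{h : Fin k → Fin n | IsOccurrence q p h ∧ univ.image h ⊆ univ.image g} := by
  have hmul (τ : Perm (Fin m)) : num q τ * num τ p = ∑ g : Fin m → Fin n,
      if IsOccurrence τ p g then #{f : Fin k → Fin m | IsOccurrence q p (g ∘ f)} else 0 := by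
    rw [mul_comm, ← sum_filter, num.eq_1 τ, ← smul_eq_mul, ← sum_const]
    refine sum_congr rfl fun g hg => ?_
    simp only [num, (mem_filter.1 hg).2.comp_iff]
  simp_rw [hmul]
  rw [sum_comm, sum_filter]
  refine sum_congr rfl fun g _ => ?_
  split_ifs with hg
  · obtain ⟨τ, hτ, huniq⟩ := existsUnique_isOccurrence p hg
    rw [sum_eq_single_of_mem τ (mem_univ τ) fun σ _ hσ => if_neg fun h => hσ (huniq σ h), if_pos hτ,
      card_isOccurrence_comp q p hg]
  · exact sum_eq_zero fun τ _ => if_neg fun h => hg h.strictMono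

/-- An occurrence of `q` extends to `(n - k).choose (m - k)` sets of `m` positions, and each such
set is an occurrence of exactly one `τ`. -/
theorem sum_num_mul_num (hkm : k ≤ m) (q : Perm (Fin k)) (p : Perm (Fin n)) :
    ∑ τ : Perm (Fin m), num q τ * num τ p = (n - k).choose (m - k) * num q p := by
  have hbelow (h : Fin k → Fin n) (hh : IsOccurrence q p h) :
      #{g : Fin m → Fin n | StrictMono g ∧ univ.image h ⊆ univ.image g} =
        (n - k).choose (m - k) := by
    have hcard : #(univ.image h) = k := by
      simpa using card_image_of_injective univ hh.strictMono.injective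
    rw [card_strictMono_filter_image, card_powersetCard_filter_superset (by rwa [hcard]), hcard,
      Fintype.card_fin]
  rw [sum_num_mul_num_eq_sum_strictMono]
  have hcount := sum_card_bipartiteAbove_eq_sum_card_bipartiteBelow
    (s := {g : Fin m → Fin n | StrictMono g}) (t := {h : Fin k → Fin n | IsOccurrence q p h})
    fun g h => univ.image h ⊆ univ.image g
  simp only [bipartiteAbove, bipartiteBelow, filter_filter] at hcount
  rw [hcount, mul_comm, num, ← smul_eq_mul, ← sum_const]
  exact sum_congr rfl fun h hh => hbelow h (mem_filter.1 hh).2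

end DoubleCounting

section Append

variable {n k : ℕ}

/-- The permutation obtained from `σ` by appending the last entry `v` and raising by one the entries
that are at least `v`. -/
def snocPerm (v : Fin (n + 1)) (σ : Perm (Fin n)) : Perm (Fin (n + 1)) :=
  (finSuccEquiv' (Fin.last n)).trans ((optionCongr σ).trans (finSuccEquiv' v).symm)

@[simp]
theorem snocPerm_last (v : Fin (n + 1)) (σ : Perm (Fin n)) : snocPerm v σ (Fin.last n) = v := by
  simp [snocPerm]

@[simp]
theorem snocPerm_castSucc (v : Fin (n + 1)) (σ : Perm (Fin n)) (i : Fin n) :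
    snocPerm v σ i.castSucc = v.succAbove (σ i) := by
  simp [snocPerm, finSuccEquiv'_last_apply_castSucc]

theorem snocPerm_bijective :
    Function.Bijective fun x : Fin (n + 1) × Perm (Fin n) => snocPerm x.1 x.2 := by
  rw [Fintype.bijective_iff_injective_and_card]
  refine ⟨fun ⟨v, σ⟩ ⟨v', σ'⟩ h => ?_, by simp [Fintype.card_perm, Nat.factorial_succ]⟩
  obtain rfl : v = v' := by simpa using Equiv.congr_fun h (Fin.last n)
  congr
  ext i : 1
  simpa using Equiv.congr_fun h i.castSucc

theorem sum_perm_succ {M : Type*} [AddCommMonoid M] (f : Perm (Fin (n + 1)) → M) :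
    ∑ p, f p = ∑ v, ∑ σ, f (snocPerm v σ) := by
  rw [← Fintype.sum_prod_type', snocPerm_bijective.sum_comp f]

theorem val_succAbove_lt_iff {v : Fin (n + 1)} {x : Fin n} {t : ℕ} (ht : t ≤ v) :
    (v.succAbove x : ℕ) < t ↔ (x : ℕ) < t := by
  rcases lt_or_ge x.castSucc v with hx | hx
  · rw [Fin.succAbove_of_castSucc_lt _ _ hx, Fin.val_castSucc]
  · rw [Fin.succAbove_of_le_castSucc _ _ hx, Fin.val_succ]
    rw [Fin.le_def, Fin.val_castSucc] at hx
    omega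

theorem isOccurrence_castSucc (v : Fin (n + 1)) (σ : Perm (Fin n)) :
    IsOccurrence σ (snocPerm v σ) Fin.castSucc :=
  ⟨fun _ _ => Fin.castSucc_lt_castSucc_iff.2, by simp⟩

theorem isOccurrence_snoc_iff {q : Perm (Fin k)} {v : Fin (n + 1)} {σ : Perm (Fin n)}
    {f : Fin k → Fin n} :
    IsOccurrence (snocPerm (Fin.last k) q) (snocPerm v σ)
        (Fin.snoc (α := fun _ => Fin (n + 1)) (Fin.castSucc ∘ f) (Fin.last n)) ↔
      IsOccurrence q σ f ∧ ∀ i, (σ (f i) : ℕ) < v := by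
  have lt_iff (x : Fin n) : v.succAbove x < v ↔ (x : ℕ) < v := val_succAbove_lt_iff le_rfl
  have not_lt_iff (x : Fin n) : ¬ v < v.succAbove x ↔ (x : ℕ) < v := by
    rw [← lt_iff, not_lt, le_iff_lt_or_eq, or_iff_left (Fin.succAbove_ne v x)]
  simp [IsOccurrence, Fin.forall_fin_succ', Fin.not_lt.2 (Fin.le_last _), lt_iff, not_lt_iff,
    forall_and, and_assoc]

/-- The number of occurrences of `q` in `p` that only involve entries less than `t`. -/
def numBelow (t : ℕ) (q : Perm (Fin k)) (p : Perm (Fin n)) : ℕ :=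
  #{f : Fin k → Fin n | IsOccurrence q p f ∧ ∀ i, (p (f i) : ℕ) < t}

theorem card_isOccurrence_last_ne (q : Perm (Fin (k + 1))) (v : Fin (n + 1)) (σ : Perm (Fin n)) :
    #{F | IsOccurrence q (snocPerm v σ) F ∧ F (Fin.last k) ≠ Fin.last n} = num q σ := by
  symm
  refine card_bij (fun f _ => Fin.castSucc ∘ f) (fun f hf => ?_)
    (fun f _ f' _ h => (Fin.castSucc_injective n).comp_left h) fun F hF => ?_
  · rw [mem_filter] at hf ⊢
    exact ⟨mem_univ _, (isOccurrence_castSucc v σ).comp_iff.2 hf.2, Fin.castSucc_ne_last _⟩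
  · obtain ⟨-, hocc, hlast⟩ := mem_filter.1 hF
    have hne (i) : F i ≠ Fin.last n :=
      ((hocc.strictMono.monotone (Fin.le_last i)).trans_lt (Fin.lt_last_iff_ne_last.2 hlast)).ne
    choose f hf using fun i => Fin.exists_castSucc_eq.2 (hne i)
    obtain rfl : Fin.castSucc ∘ f = F := funext hf
    exact ⟨f, mem_filter.2 ⟨mem_univ _, (isOccurrence_castSucc v σ).comp_iff.1 hocc⟩, rfl⟩

theorem card_isOccurrence_last_eq (q : Perm (Fin k)) (v : Fin (n + 1)) (σ : Perm (Fin n)) :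
    #{F | IsOccurrence (snocPerm (Fin.last k) q) (snocPerm v σ) F ∧ F (Fin.last k) = Fin.last n} =
      numBelow v q σ := by
  symm
  refine card_bij (fun f _ => Fin.snoc (Fin.castSucc ∘ f) (Fin.last n)) (fun f hf => ?_)
    (fun f _ f' _ h => (Fin.castSucc_injective n).comp_left (Fin.snoc_inj.1 h).1) fun F hF => ?_
  · rw [mem_filter] at hf ⊢
    exact ⟨mem_univ _, isOccurrence_snoc_iff.2 hf.2, Fin.snoc_last ..⟩
  · obtain ⟨-, hocc, hlast⟩ := mem_filter.1 hF
    have hne (i : Fin k) : F i.castSucc ≠ Fin.last n :=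
      ((hocc.strictMono (Fin.castSucc_lt_last i)).trans_eq hlast).ne
    choose f hf using fun i => Fin.exists_castSucc_eq.2 (hne i)
    obtain rfl : Fin.snoc (Fin.castSucc ∘ f) (Fin.last n) = F := by
      rw [← Fin.snoc_init_self F, hlast]
      congr 1
      exact funext hf
    exact ⟨f, mem_filter.2 ⟨mem_univ _, isOccurrence_snoc_iff.1 hocc⟩, rfl⟩

theorem num_snocPerm_last_snocPerm (q : Perm (Fin k)) (v : Fin (n + 1)) (σ : Perm (Fin n)) :
    num (snocPerm (Fin.last k) q) (snocPerm v σ) =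
      num (snocPerm (Fin.last k) q) σ + numBelow v q σ := by
  rw [num, ← card_filter_add_card_filter_not fun F => F (Fin.last k) ≠ Fin.last n]
  simp only [filter_filter, not_not, card_isOccurrence_last_ne, card_isOccurrence_last_eq]

/-- The entries of `p` less than `s` form a decreasing sequence. -/
abbrev LowDecreasing (s : ℕ) (p : Perm (Fin n)) : Prop :=
  StrictAntiOn p {i | (p i : ℕ) < s}

theorem numBelow_revPerm {t : ℕ} {p : Perm (Fin n)} (ht : t ≤ n) (hp : LowDecreasing t p) :
    numBelow t (Fin.revPerm : Perm (Fin k)) p = t.choose k := by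
  set L : Finset (Fin n) := {i | (p i : ℕ) < t} with hL
  have hcard : #L = t := by
    rw [← card_map p.toEmbedding]
    trans #{x : Fin n | (x : ℕ) < t}
    · congr 1
      ext x
      simp [hL]
    · rw [Fin.card_filter_val_lt, min_eq_right ht]
  have hocc (f : Fin k → Fin n) : (IsOccurrence Fin.revPerm p f ∧ ∀ i, (p (f i) : ℕ) < t) ↔
      StrictMono f ∧ univ.image f ⊆ L := by
    have hsub : univ.image f ⊆ L ↔ ∀ i, (p (f i) : ℕ) < t := by simp [image_subset_iff, hL]
    rw [hsub]
    refine and_congr_left fun hf => ⟨IsOccurrence.strictMono, fun h => ⟨fun _ _ => @h _ _,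
      fun i j => ?_⟩⟩
    rw [hp.lt_iff_gt (hf i) (hf j), h.lt_iff_lt]
    simp
  simp only [numBelow, hocc]
  rw [card_strictMono_filter_image (· ⊆ L), ← hcard, ← card_powersetCard]
  congr 1
  ext S
  simp [mem_powersetCard, and_comm]

theorem numBelow_one_eq_zero_iff {t : ℕ} {p : Perm (Fin n)} :
    numBelow t (1 : Perm (Fin 2)) p = 0 ↔ LowDecreasing t p := by
  rw [numBelow, card_eq_zero, filter_eq_empty_iff]
  refine ⟨fun h i hi j hj hij => ?_, fun h f _ hf => ?_⟩
  · refine (p.injective.ne hij.ne').lt_of_le (not_lt.1 fun hlt => h (mem_univ ![i, j]) ?_)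
    simpa [IsOccurrence, Fin.forall_fin_two, hij, hij.le, hlt, hlt.le] using ⟨hi, hj⟩
  · exact (h (hf.2 0) (hf.2 1) (hf.1.1 _ _ zero_lt_one)).asymm ((hf.1.2 0 1).1 zero_lt_one)

theorem snocPerm_last_one : snocPerm (Fin.last k) 1 = 1 := by
  ext i
  induction i using Fin.lastCases <;> simp

theorem snocPerm_mem_Av_pat123 {v : Fin (n + 1)} {σ : Perm (Fin n)} :
    snocPerm v σ ∈ Av (n + 1) pat123 ↔ σ ∈ Av n pat123 ∧ LowDecreasing v σ := by
  rw [mem_Av_iff_num_eq_zero, mem_Av_iff_num_eq_zero, pat123, ← snocPerm_last_one,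
    num_snocPerm_last_snocPerm, Nat.add_eq_zero_iff, numBelow_one_eq_zero_iff]

theorem LowDecreasing.mono {s t : ℕ} {p : Perm (Fin n)} (hp : LowDecreasing t p) (hst : s ≤ t) :
    LowDecreasing s p :=
  StrictAntiOn.mono hp fun _ => hst.trans_lt'

end Append

section GeneratingTree

theorem lowDecreasing_zero {n : ℕ} (p : Perm (Fin n)) : LowDecreasing 0 p := by
  simp [LowDecreasing, StrictAntiOn]

theorem lowDecreasing_one {n : ℕ} (p : Perm (Fin n)) : LowDecreasing 1 p := by
  intro i hi j hj hij
  simp only [Set.mem_ofPred_eq, Nat.lt_one_iff] at hi hj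
  exact absurd (p.injective (Fin.ext (hi.trans hj.symm))) hij.ne

theorem lowDecreasing_succ_snocPerm_zero {n s : ℕ} {σ : Perm (Fin n)} :
    LowDecreasing (s + 1) (snocPerm 0 σ) ↔ LowDecreasing s σ := by
  simp [LowDecreasing, StrictAntiOn, Fin.forall_fin_succ', Fin.not_lt.2 (Fin.le_last _)]

theorem lowDecreasing_snocPerm {n s : ℕ} {v : Fin (n + 1)} (hv : v ≠ 0) {σ : Perm (Fin n)}
    (hσ : LowDecreasing v σ) : LowDecreasing s (snocPerm v σ) ↔ s ≤ v := by
  refine ⟨fun hs => ?_, fun hs => ?_⟩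
  · by_contra! hlt
    have : NeZero n := ⟨by rintro rfl; exact hv (Fin.fin_one_eq_zero v)⟩
    have h0 : snocPerm v σ (σ⁻¹ 0).castSucc = 0 := by simp [Fin.succAbove_ne_zero_zero hv]
    have hlast : (snocPerm v σ (Fin.last n) : ℕ) < s := by simpa using hlt
    have hdec := hs (show (snocPerm v σ (σ⁻¹ 0).castSucc : ℕ) < s by rw [h0]; exact pos_of_gt hlt)
      hlast (Fin.castSucc_lt_last _)
    exact absurd (h0 ▸ hdec) (Fin.not_lt_zero _)
  · have hσs := hσ.mono hs
    simpa [LowDecreasing, StrictAntiOn, Fin.forall_fin_succ', Fin.not_lt.2 (Fin.le_last _),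
      val_succAbove_lt_iff hs, hs.not_gt] using hσs

open Classical in
/-- The `123`-avoiding permutations of length `n` whose entries less than `s` form a decreasing
sequence of length `s`; the set is empty when `n < s`. -/
noncomputable def avLow (n s : ℕ) : Finset (Perm (Fin n)) :=
  {p ∈ Av n pat123 | s ≤ n ∧ LowDecreasing s p}

theorem mem_avLow {n s : ℕ} {p : Perm (Fin n)} :
    p ∈ avLow n s ↔ p ∈ Av n pat123 ∧ s ≤ n ∧ LowDecreasing s p :=
  mem_filter

theorem avLow_eq_empty {n s : ℕ} (h : n < s) : avLow n s = ∅ :=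
  eq_empty_of_forall_notMem fun _ hp => h.not_ge (mem_avLow.1 hp).2.1

theorem avLow_zero (n : ℕ) : avLow n 0 = Av n pat123 := by
  ext p
  simp [mem_avLow, lowDecreasing_zero]

theorem avLow_one {n : ℕ} (hn : n ≠ 0) : avLow n 1 = avLow n 0 := by
  ext p
  simp [mem_avLow, lowDecreasing_zero, lowDecreasing_one, Nat.one_le_iff_ne_zero, hn]

theorem snocPerm_mem_avLow {n s : ℕ} {v : Fin (n + 1)} {σ : Perm (Fin n)} :
    snocPerm v σ ∈ avLow (n + 1) (s + 1) ↔
      (v = 0 ∧ σ ∈ avLow n s) ∨ (s + 1 ≤ v ∧ σ ∈ avLow n v) := by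
  simp only [mem_avLow, snocPerm_mem_Av_pat123, Nat.add_le_add_iff_right]
  by_cases hv : v = 0
  · subst hv
    simp [lowDecreasing_succ_snocPerm_zero, lowDecreasing_zero]
  · have hvn := v.is_le
    constructor
    · rintro ⟨⟨hav, hlow⟩, -, hs⟩
      exact .inr ⟨(lowDecreasing_snocPerm hv hlow).1 hs, hav, hvn, hlow⟩
    · rintro (⟨h0, -⟩ | ⟨hs, hav, -, hlow⟩)
      · exact absurd h0 hv
      · exact ⟨⟨hav, hlow⟩, by omega, (lowDecreasing_snocPerm hv hlow).2 hs⟩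

/-- The statistic `f` grows by `φ v` when `v` is appended to a permutation whose entries less than
`v` form a decreasing sequence, as they do when the result avoids `123`. -/
def IsAppendAdditive (f : ∀ n, Perm (Fin n) → ℚ) (φ : ℕ → ℚ) : Prop :=
  ∀ ⦃n⦄ (v : Fin (n + 1)) (σ : Perm (Fin n)), LowDecreasing v σ →
    f (n + 1) (snocPerm v σ) = f n σ + φ v

theorem isAppendAdditive_const (a : ℚ) : IsAppendAdditive (fun _ _ => a) 0 := by
  simp [IsAppendAdditive]

theorem isAppendAdditive_num_revPerm (k : ℕ) :
    IsAppendAdditive (fun _ p => (num (snocPerm (Fin.last k) Fin.revPerm) p : ℚ))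
      fun v => (v.choose k : ℚ) := by
  intro n v σ hσ
  beta_reduce
  rw [num_snocPerm_last_snocPerm, numBelow_revPerm v.is_le hσ, Nat.cast_add]

variable {f : ∀ n, Perm (Fin n) → ℚ} {φ : ℕ → ℚ}

theorem IsAppendAdditive.sum_avLow_succ (hf : IsAppendAdditive f φ) (hφ : φ 0 = 0) (n s : ℕ) :
    ∑ p ∈ avLow (n + 1) (s + 1), f (n + 1) p = ∑ σ ∈ avLow n s, f n σ +
      ∑ v ∈ Ico (s + 1) (n + 1), ∑ σ ∈ avLow n v, (f n σ + φ v) := by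
  have hsnoc (v : Fin (n + 1)) :
      (∑ σ, if snocPerm v σ ∈ avLow (n + 1) (s + 1) then f (n + 1) (snocPerm v σ) else 0) =
        (if v = 0 then ∑ σ ∈ avLow n s, f n σ else 0) +
          if s + 1 ≤ (v : ℕ) then ∑ σ ∈ avLow n v, (f n σ + φ v) else 0 := by
    simp only [snocPerm_mem_avLow]
    rcases eq_or_ne v 0 with rfl | hv
    · have h0 (σ : Perm (Fin n)) : f (n + 1) (snocPerm 0 σ) = f n σ := by
        rw [hf 0 σ (lowDecreasing_zero σ), Fin.val_zero, hφ, add_zero]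
      simp [h0, sum_ite_mem]
    · by_cases hs : s + 1 ≤ (v : ℕ)
      · simp only [hv, hs, false_and, true_and, false_or, if_false, if_true, zero_add, sum_ite_mem,
          univ_inter]
        exact sum_congr rfl fun σ hσ => hf v σ (mem_avLow.1 hσ).2.2
      · simp [hv, hs]
  have hIco : ∑ v : Fin (n + 1),
      (if s + 1 ≤ (v : ℕ) then ∑ σ ∈ avLow n v, (f n σ + φ v) else 0) =
        ∑ v ∈ Ico (s + 1) (n + 1), ∑ σ ∈ avLow n v, (f n σ + φ v) := by
    rw [Fin.sum_univ_eq_sum_range fun v => if s + 1 ≤ v then ∑ σ ∈ avLow n v, (f n σ + φ v) else 0,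
      ← sum_filter]
    congr 1
    ext v
    simp [and_comm]
  rw [← sum_ite_mem_eq, sum_perm_succ]
  simp_rw [hsnoc]
  rw [sum_add_distrib, hIco, sum_ite_eq' univ, if_pos (mem_univ _)]

/-- The generating function of the statistic `f` over the sets `avLow n s`. -/
noncomputable def lowGF (f : ∀ n, Perm (Fin n) → ℚ) (s : ℕ) : ℚ⟦X⟧ :=
  .mk fun n => ∑ p ∈ avLow n s, f n p

theorem X_pow_dvd_lowGF (f : ∀ n, Perm (Fin n) → ℚ) (s : ℕ) : X ^ s ∣ lowGF f s := by
  rw [X_pow_dvd_iff]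
  intro m hm
  rw [lowGF, coeff_mk, avLow_eq_empty hm, sum_empty]

theorem lowGF_zero (f : ∀ n, Perm (Fin n) → ℚ) : lowGF f 0 = C (f 0 1) + lowGF f 1 := by
  ext n
  rcases eq_or_ne n 0 with rfl | hn
  · have hav : Av 0 pat123 = {1} := by decide
    simp [lowGF, avLow_zero, avLow_eq_empty, hav]
  · simp [lowGF, avLow_one hn, coeff_C, hn]

theorem IsAppendAdditive.lowGF_sub_lowGF (hf : IsAppendAdditive f φ) (hφ : φ 0 = 0) (s : ℕ) :
    lowGF f (s + 1) - lowGF f (s + 2) =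
      X * (lowGF f s + C (φ (s + 1)) * lowGF (fun _ _ => 1) (s + 1)) := by
  ext n
  rcases n with _ | n
  · simp [lowGF, avLow_eq_empty]
  · rw [coeff_succ_X_mul]
    simp only [lowGF, map_sub, map_add, coeff_mk, coeff_C_mul, hf.sum_avLow_succ hφ]
    rcases lt_or_ge n (s + 1) with hns | hns
    · simp [Ico_eq_empty_of_le (Nat.add_le_add_right hns.le 1),
        Ico_eq_empty_of_le (show n + 1 ≤ s + 1 by omega), avLow_eq_empty hns]
    · rw [sum_eq_sum_Ico_succ_bot (show s + 1 < n + 1 by omega), sum_add_distrib, mul_sum]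
      simp only [mul_one]
      ring

end GeneratingTree

section BinomialSums

theorem one_sub_mul_sum_choose_succ {R : Type*} [CommRing R] (u : R) (k N : ℕ) :
    (1 - u) * ∑ v ∈ range N, (v.choose (k + 1) : R) * u ^ v =
      u * ∑ v ∈ range N, (v.choose k : R) * u ^ v - N.choose (k + 1) * u ^ N := by
  induction N with
  | zero => simp
  | succ N ih =>
    rw [sum_range_succ, sum_range_succ, mul_add, ih, Nat.choose_succ_succ N k, Nat.cast_add]
    ring

theorem pow_dvd_one_sub_pow_mul_sum_choose {R : Type*} [CommRing R] (u : R) (k N : ℕ) :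
    u ^ N ∣ (1 - u) ^ (k + 1) * ∑ v ∈ range N, (v.choose k : R) * u ^ v - u ^ k := by
  induction k with
  | zero => exact ⟨-1, by simp [mul_neg_geom_sum]⟩
  | succ k ih =>
    obtain ⟨d, hd⟩ := ih
    refine ⟨u * d - (1 - u) ^ (k + 1) * N.choose (k + 1), ?_⟩
    rw [pow_succ (1 - u), mul_assoc, one_sub_mul_sum_choose_succ]
    linear_combination u * hd

end BinomialSums

section Catalan

theorem catalanGF_sq_mul_X_add_one : catalanGF ^ 2 * X + 1 = catalanGF := by
  simpa [catalanGF] using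
    congrArg (PowerSeries.map (Nat.castRingHom ℚ)) catalanSeries_sq_mul_X_add_one

theorem catalanGF_mul_one_sub_X_mul_catalanGF : catalanGF * (1 - X * catalanGF) = 1 := by
  linear_combination -catalanGF_sq_mul_X_add_one

theorem catalanGF_ne_zero : catalanGF ≠ 0 :=
  left_ne_zero_of_mul_eq_one catalanGF_mul_one_sub_X_mul_catalanGF

theorem X_eq_X_mul_catalanGF_mul_one_sub : X = X * catalanGF * (1 - X * catalanGF) := by
  linear_combination X * catalanGF_sq_mul_X_add_one

theorem one_sub_two_mul_X_mul_catalanGF_sq : (1 - 2 * (X * catalanGF)) ^ 2 = 1 - 4 * X := by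
  linear_combination 4 * X * catalanGF_sq_mul_X_add_one

theorem X_mul_catalanGF_pow_three_eq :
    (X * catalanGF) ^ 3 = C (1 / 2) * (1 - 3 * X - (1 - X) * (1 - 2 * (X * catalanGF))) := by
  have hC : C (1 / 2) * 2 = (1 : ℚ⟦X⟧) := by
    rw [← map_ofNat (C (R := ℚ)) 2, ← map_mul]
    norm_num
  linear_combination (1 + X * catalanGF) * X_eq_X_mul_catalanGF_mul_one_sub -
    (X * catalanGF - X - X * (X * catalanGF)) * hC

theorem derivative_X_mul_catalanGF :
    d⁄dX ℚ (X * catalanGF) * (1 - 2 * (X * catalanGF)) = 1 := by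
  have hr := congrArg (d⁄dX ℚ) X_eq_X_mul_catalanGF_mul_one_sub
  simp only [Derivation.leibniz, map_sub, Derivation.map_one_eq_zero, derivative_X, smul_eq_mul]
    at hr ⊢
  linear_combination -hr

end Catalan

section KernelMethod

theorem eq_zero_of_forall_X_pow_dvd {R : Type*} [Semiring R] {g : R⟦X⟧} (h : ∀ N, X ^ N ∣ g) :
    g = 0 := by
  ext n
  exact X_pow_dvd_iff.1 (h (n + 1)) n n.lt_succ_self

theorem X_pow_dvd_sub_sum {R : Type*} [CommRing R] {G e : ℕ → R⟦X⟧} {c : R⟦X⟧}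
    (hG : ∀ s, X ^ s ∣ G s) (h : ∀ s, G s = c * G (s + 1) + e s) (N : ℕ) :
    X ^ N ∣ G 0 - ∑ s ∈ range N, c ^ s * e s := by
  have hN : G 0 - ∑ s ∈ range N, c ^ s * e s = c ^ N * G N := by
    induction N with
    | zero => simp
    | succ N ih =>
      rw [sum_range_succ, ← sub_sub, ih, h N]
      ring
  exact hN ▸ (hG N).mul_left _

variable {f : ∀ n, Perm (Fin n) → ℚ} {φ : ℕ → ℚ}

/-- With `r = X * catalanGF`, the characteristic polynomial `z ^ 2 - z + X` of the recurrence for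
`lowGF f` is `(z - r) * (z - (1 - r))`; dividing out the first factor leaves a first-order
recurrence. -/
theorem IsAppendAdditive.lowGF_sub_mul_lowGF (hf : IsAppendAdditive f φ) (hφ : φ 0 = 0) (s : ℕ) :
    lowGF f (s + 1) - X * catalanGF * lowGF f s =
      catalanGF * (lowGF f (s + 2) - X * catalanGF * lowGF f (s + 1)) +
        X * catalanGF * (C (φ (s + 1)) * lowGF (fun _ _ => 1) (s + 1)) := by
  linear_combination catalanGF * hf.lowGF_sub_lowGF hφ s -
    lowGF f (s + 1) * catalanGF_mul_one_sub_X_mul_catalanGF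

theorem IsAppendAdditive.X_pow_dvd_lowGF_sub_sum (hf : IsAppendAdditive f φ) (hφ : φ 0 = 0)
    (N : ℕ) :
    X ^ N ∣ lowGF f 1 - X * catalanGF * lowGF f 0 - ∑ s ∈ range N,
      catalanGF ^ s * (X * catalanGF * (C (φ (s + 1)) * lowGF (fun _ _ => 1) (s + 1))) :=
  X_pow_dvd_sub_sum (G := fun s => lowGF f (s + 1) - X * catalanGF * lowGF f s)
    (fun s => ((pow_dvd_pow X s.le_succ).trans (X_pow_dvd_lowGF f _)).sub
      ((X_pow_dvd_lowGF f s).mul_left _)) (hf.lowGF_sub_mul_lowGF hφ) N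

theorem lowGF_const_one_succ (s : ℕ) :
    lowGF (fun _ _ => 1) (s + 1) = X * catalanGF * lowGF (fun _ _ => 1) s := by
  have hadd := isAppendAdditive_const 1
  rw [← sub_eq_zero]
  induction s with
  | zero =>
    refine eq_zero_of_forall_X_pow_dvd fun N => ?_
    simpa using hadd.X_pow_dvd_lowGF_sub_sum rfl N
  | succ s ih =>
    have hstep := hadd.lowGF_sub_mul_lowGF rfl s
    rw [ih, Pi.zero_apply, map_zero, zero_mul, mul_zero, add_zero, eq_comm] at hstep
    exact (mul_eq_zero.1 hstep).resolve_left catalanGF_ne_zero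

theorem lowGF_const_one (s : ℕ) : lowGF (fun _ _ => 1) s = (X * catalanGF) ^ s * catalanGF := by
  induction s with
  | zero =>
    have h0 := lowGF_zero fun _ _ => 1
    rw [lowGF_const_one_succ, map_one] at h0
    linear_combination catalanGF * h0 -
      lowGF (fun _ _ => 1) 0 * catalanGF_mul_one_sub_X_mul_catalanGF
  | succ s ih =>
    rw [lowGF_const_one_succ, ih]
    ring

theorem IsAppendAdditive.X_pow_dvd_lowGF_zero_sub_sum (hf : IsAppendAdditive f φ) (hφ : φ 0 = 0)
    (hf0 : f 0 1 = 0) (N : ℕ) :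
    X ^ N ∣ lowGF f 0 -
      (catalanGF - 1) * ∑ v ∈ range (N + 1), C (φ v) * (catalanGF - 1) ^ v := by
  have hu : catalanGF - 1 = X * catalanGF * catalanGF := by
    linear_combination -catalanGF_sq_mul_X_add_one
  have hF : lowGF f 1 - X * catalanGF * lowGF f 0 = (1 - X * catalanGF) * lowGF f 0 := by
    rw [lowGF_zero f, hf0, map_zero]
    ring
  have hsum : ∑ s ∈ range N,
      catalanGF ^ s * (X * catalanGF * (C (φ (s + 1)) * lowGF (fun _ _ => 1) (s + 1))) =
        X * catalanGF * ∑ v ∈ range (N + 1), C (φ v) * (catalanGF - 1) ^ v := by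
    rw [sum_range_succ', hφ, map_zero, zero_mul, add_zero, mul_sum]
    refine sum_congr rfl fun s _ => ?_
    rw [lowGF_const_one, hu]
    ring
  have hdvd := (hf.X_pow_dvd_lowGF_sub_sum hφ N).mul_left catalanGF
  rw [hF, hsum] at hdvd
  convert hdvd using 1
  linear_combination -lowGF f 0 * catalanGF_mul_one_sub_X_mul_catalanGF -
    (∑ v ∈ range (N + 1), C (φ v) * (catalanGF - 1) ^ v) * hu

theorem IsAppendAdditive.lowGF_zero_mul_pow {k : ℕ}
    (hf : IsAppendAdditive f fun v => (v.choose (k + 1) : ℚ)) (hf0 : f 0 1 = 0) :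
    lowGF f 0 * (1 - 2 * (X * catalanGF)) ^ (k + 2) = (X * catalanGF) ^ (k + 2) := by
  set u := catalanGF - 1 with hu
  have hXu : X ∣ u := ⟨catalanGF ^ 2, by linear_combination -catalanGF_sq_mul_X_add_one⟩
  have hF : lowGF f 0 * (1 - u) ^ (k + 2) = u ^ (k + 2) := by
    rw [← sub_eq_zero]
    refine eq_zero_of_forall_X_pow_dvd fun N => ?_
    have hF' := (hf.X_pow_dvd_lowGF_zero_sub_sum (by simp) hf0 N).mul_left ((1 - u) ^ (k + 2))
    have hsum := (((pow_dvd_pow X N.le_succ).trans (pow_dvd_pow_of_dvd hXu (N + 1))).trans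
      (pow_dvd_one_sub_pow_mul_sum_choose u (k + 1) (N + 1))).mul_left u
    convert hF'.add hsum using 1
    simp only [map_natCast, ← hu]
    ring
  have hr : u = catalanGF * (X * catalanGF) := by
    linear_combination hu - catalanGF_sq_mul_X_add_one
  have hs : 1 - u = catalanGF * (1 - 2 * (X * catalanGF)) := by
    linear_combination -hr - catalanGF_mul_one_sub_X_mul_catalanGF
  rw [hs, hr, mul_pow, mul_pow, mul_left_comm] at hF
  exact mul_left_cancel₀ (pow_ne_zero _ catalanGF_ne_zero) hF

end KernelMethod

section PatternSeries

/-- The generating function of the total number of occurrences of `q` in the permutations avoiding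
`123`. -/
noncomputable def patternGF {k : ℕ} (q : Perm (Fin k)) : ℚ⟦X⟧ :=
  .mk fun n => (total q (Av n pat123) : ℚ)

theorem patternGF_eq_lowGF {k : ℕ} (q : Perm (Fin k)) :
    patternGF q = lowGF (fun _ p => (num q p : ℚ)) 0 := by
  simp [patternGF, lowGF, total, avLow_zero]

/-- In one-line notation the pattern is `k + 1, …, 2, 1, k + 2`. -/
theorem patternGF_snocPerm_last_revPerm (k : ℕ) :
    patternGF (snocPerm (Fin.last (k + 1)) Fin.revPerm) * (1 - 2 * (X * catalanGF)) ^ (k + 2) =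
      (X * catalanGF) ^ (k + 2) := by
  rw [patternGF_eq_lowGF]
  refine (isAppendAdditive_num_revPerm (k + 1)).lowGF_zero_mul_pow ?_
  simp [num]

end PatternSeries

section ThreeLetterPatterns

/-- The permutation 12. -/
def pat12 : Perm (Fin 2) := 1

/-- The permutation 132. -/
def pat132 : Perm (Fin 3) := swap 1 2

/-- The permutation 213. -/
def pat213 : Perm (Fin 3) := swap 0 1

theorem total_pat312 (n : ℕ) : total pat312 (Av n pat123) = total pat231 (Av n pat123) :=
  total_inv pat231 pat123

theorem total_pat132 (n : ℕ) : total pat132 (Av n pat123) = total pat213 (Av n pat123) := by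
  rw [← total_revComp, show revComp pat132 = pat213 by decide,
    show revComp pat123 = pat123 by decide]

theorem num_eq_zero_of_lt {n k : ℕ} (h : n < k) (q : Perm (Fin k)) (p : Perm (Fin n)) :
    num q p = 0 := by
  rw [num, card_eq_zero, filter_eq_empty_iff]
  intro f _ hf
  simpa [h.not_ge] using Fintype.card_le_of_injective f hf.strictMono.injective

theorem sum_num_pattern_three {n : ℕ} {p : Perm (Fin n)} (hp : p ∈ Av n pat123) :
    2 * num pat132 p + 2 * num pat213 p + num pat231 p + num pat312 p =
      (n - 2) * num pat12 p := by
  have huniv : (univ : Finset (Perm (Fin 3))) =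
      {pat123, pat132, pat213, pat231, pat312, Fin.revPerm} := by decide
  have h12 : num pat12 pat132 = 2 ∧ num pat12 pat213 = 2 ∧ num pat12 pat231 = 1 ∧
    num pat12 pat312 = 1 ∧ num pat12 (Fin.revPerm : Perm (Fin 3)) = 0 := by decide
  have hsum := sum_num_mul_num (m := 3) (Nat.le_succ 2) pat12 p
  rw [huniv, sum_insert (by decide), sum_insert (by decide), sum_insert (by decide),
    sum_insert (by decide), sum_insert (by decide), sum_singleton, mem_Av_iff_num_eq_zero.1 hp,
    Nat.choose_one_right] at hsum
  simp only [h12] at hsum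
  linarith

theorem total_pattern_three (n : ℕ) :
    4 * total pat213 (Av n pat123) + 2 * total pat231 (Av n pat123) =
      (n - 2) * total pat12 (Av n pat123) := by
  have hsum := sum_congr rfl fun p (hp : p ∈ Av n pat123) => sum_num_pattern_three hp
  simp only [sum_add_distrib, ← mul_sum] at hsum
  change 2 * total pat132 _ + 2 * total pat213 _ + total pat231 _ + total pat312 _ =
    (n - 2) * total pat12 _ at hsum
  rw [total_pat132, total_pat312] at hsum
  linarith

theorem patternGF_pat213_add_patternGF_pat231 :
    4 * patternGF pat213 + 2 * patternGF pat231 =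
      X * d⁄dX ℚ (patternGF pat12) - 2 * patternGF pat12 := by
  ext n
  have hderiv (F : ℚ⟦X⟧) : coeff n (X * d⁄dX ℚ F) = n * coeff n F := by
    rcases n with _ | n
    · simp
    · rw [coeff_succ_X_mul, coeff_derivative, Nat.cast_succ, mul_comm]
  have htotal : ((4 * total pat213 (Av n pat123) + 2 * total pat231 (Av n pat123) : ℕ) : ℚ) =
      (n - 2) * (total pat12 (Av n pat123) : ℚ) := by
    rw [total_pattern_three, Nat.cast_mul]
    rcases lt_or_ge n 2 with hn | hn
    · simp [total, num_eq_zero_of_lt hn]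
    · rw [Nat.cast_sub hn, Nat.cast_two]
  have hcoeff (m : ℕ) [m.AtLeastTwo] (F : ℚ⟦X⟧) :
      coeff n (OfNat.ofNat m * F) = OfNat.ofNat m * coeff n F := by
    rw [← map_ofNat (C (R := ℚ)), coeff_C_mul]
  push_cast at htotal
  simp only [map_add, map_sub, hderiv, hcoeff, patternGF, coeff_mk]
  linear_combination htotal

theorem patternGF_pat12_mul_sq :
    patternGF pat12 * (1 - 2 * (X * catalanGF)) ^ 2 = (X * catalanGF) ^ 2 := by
  rw [← patternGF_snocPerm_last_revPerm 0,
    show snocPerm (Fin.last 1) Fin.revPerm = pat12 by decide]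

theorem patternGF_pat213_mul_cube :
    patternGF pat213 * (1 - 2 * (X * catalanGF)) ^ 3 = (X * catalanGF) ^ 3 := by
  rw [← patternGF_snocPerm_last_revPerm 1,
    show snocPerm (Fin.last 2) Fin.revPerm = pat213 by decide]

theorem derivative_patternGF_pat12_mul_pow_four :
    d⁄dX ℚ (patternGF pat12) * (1 - 2 * (X * catalanGF)) ^ 4 = 2 * (X * catalanGF) := by
  have hr := derivative_X_mul_catalanGF
  have hN := patternGF_pat12_mul_sq
  generalize X * catalanGF = r at *
  have h2 : d⁄dX ℚ (2 : ℚ⟦X⟧) = 0 := by simpa using (d⁄dX ℚ).map_natCast 2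
  have hN' := congrArg (d⁄dX ℚ) hN
  simp only [Derivation.leibniz, Derivation.leibniz_pow, map_sub, Derivation.map_one_eq_zero,
    smul_eq_mul, nsmul_eq_mul, h2, Nat.cast_ofNat] at hN'
  linear_combination (1 - 2 * r) ^ 2 * hN' + 4 * hN +
    (2 * r * (1 - 2 * r) + 4 * patternGF pat12 * (1 - 2 * r) ^ 2) * hr

theorem patternGF_pat231_mul_pow_four :
    patternGF pat231 * (1 - 2 * (X * catalanGF)) ^ 4 = (X * catalanGF) ^ 3 := by
  have hsum := patternGF_pat213_add_patternGF_pat231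
  have hN' := derivative_patternGF_pat12_mul_pow_four
  have hN := patternGF_pat12_mul_sq
  have hA := patternGF_pat213_mul_cube
  have hX := X_eq_X_mul_catalanGF_mul_one_sub
  generalize X * catalanGF = r at *
  have : CharZero ℚ⟦X⟧ := algebraRat.charZero _
  refine mul_left_cancel₀ (two_ne_zero (α := ℚ⟦X⟧)) ?_
  linear_combination (1 - 2 * r) ^ 4 * hsum + X * hN' + 2 * r * hX - 2 * (1 - 2 * r) ^ 2 * hN -
    4 * (1 - 2 * r) * hA

end ThreeLetterPatterns

section PowersOfOneSubFourX

theorem oneSubFourXPow_add (a b : ℚ) :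
    oneSubFourXPow (a + b) = oneSubFourXPow a * oneSubFourXPow b := by
  simp [oneSubFourXPow, binomialSeries_add]

theorem oneSubFourXPow_one : oneSubFourXPow 1 = 1 - 4 * X := by
  have h := binomialSeries_nat (R := ℚ) (A := ℚ) 1
  rw [Nat.cast_one, pow_one] at h
  rw [oneSubFourXPow, h, map_add, map_one, rescale_X, map_neg, map_ofNat]
  ring

theorem constantCoeff_oneSubFourXPow (a : ℚ) : constantCoeff (oneSubFourXPow a) = 1 := by
  rw [oneSubFourXPow, ← coeff_zero_eq_constantCoeff_apply, coeff_rescale]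
  simp

theorem oneSubFourXPow_half : oneSubFourXPow (1 / 2) = 1 - 2 * (X * catalanGF) := by
  have hsq : oneSubFourXPow (1 / 2) ^ 2 = (1 - 2 * (X * catalanGF)) ^ 2 := by
    rw [one_sub_two_mul_X_mul_catalanGF_sq, sq, ← oneSubFourXPow_add, add_halves,
      oneSubFourXPow_one]
  refine (sq_eq_sq_iff_eq_or_eq_neg.1 hsq).resolve_right fun h => ?_
  have h0 := congrArg (constantCoeff (R := ℚ)) h
  norm_num [constantCoeff_oneSubFourXPow] at h0

theorem oneSubFourXPow_natCast_div_two (n : ℕ) :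
    oneSubFourXPow (n / 2) = (1 - 2 * (X * catalanGF)) ^ n := by
  induction n with
  | zero => simp [oneSubFourXPow]
  | succ n ih =>
    rw [Nat.cast_succ, add_div, oneSubFourXPow_add, ih, oneSubFourXPow_half, pow_succ]

end PowersOfOneSubFourX

end PermPattern

open PowerSeries PermPattern in
/-- All inverses are of power series with constant coefficient `1`. -/
theorem mainTheorem3 :
    (∀ n : ℕ, total pat231 (Av n pat123) = total pat312 (Av n pat123)) ∧
    (PowerSeries.mk fun n => (total pat231 (Av n pat123) : ℚ)) =
      X ^ 3 * catalanGF ^ 3 * ((1 - 2 * X * catalanGF) * oneSubFourXPow (3 / 2))⁻¹ ∧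
    (PowerSeries.mk fun n => (total pat231 (Av n pat123) : ℚ)) =
      C (1 / 2 : ℚ) * ((1 - 3 * X) * ((1 - 4 * X) ^ 2)⁻¹ -
        (4 * X ^ 2 - 5 * X + 1) * (oneSubFourXPow (5 / 2))⁻¹) := by
  have h32 : oneSubFourXPow (3 / 2) = (1 - 2 * (X * catalanGF)) ^ 3 :=
    mod_cast oneSubFourXPow_natCast_div_two 3
  have h52 : oneSubFourXPow (5 / 2) = (1 - 2 * (X * catalanGF)) ^ 5 :=
    mod_cast oneSubFourXPow_natCast_div_two 5
  have hB := patternGF_pat231_mul_pow_four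
  have hinv (n : ℕ) :
      ((1 - 2 * (X * catalanGF)) ^ n)⁻¹ * (1 - 2 * (X * catalanGF)) ^ n = 1 :=
    PowerSeries.inv_mul_cancel _ (by simp)
  rw [← patternGF]
  refine ⟨fun n => (total_pat312 n).symm, ?_, ?_⟩
  · rw [h32, eq_mul_inv_iff_mul_eq (by simp)]
    linear_combination hB
  · have hs5 : (1 - 2 * (X * catalanGF)) ^ 5 ≠ 0 := right_ne_zero_of_mul_eq_one (hinv 5)
    have hsq := one_sub_two_mul_X_mul_catalanGF_sq
    have hr := X_mul_catalanGF_pow_three_eq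
    rw [h52, ← hsq, ← pow_mul]
    refine mul_right_cancel₀ hs5 ?_
    generalize X * catalanGF = r at *
    linear_combination (1 - 2 * r) * (hB + hr) - C (1 / 2) * ((1 - 3 * X) * (1 - 2 * r) * hinv 4 -
      (4 * X ^ 2 - 5 * X + 1) * hinv 5 + (1 - X) * hsq)
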